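/- For $\xi>0$ and $x,y\in\mathbb{Z}+\tfrac12$ let $$K_{\mathrm{Bessel}}(x,y;\xi)=\frac1{(2\pi i)^2}\oint_{|z|=R}\oint_{|w|=r}\frac{e^{\sqrt\xi\,(z-z^{-1}-w+w^{-1})}}{z-w}\,\frac{dw\,dz}{z^{x+1/2}\,w^{-y+1/2}},\qquad R>r>0,$$ be the discrete Bessel kernel (both circles positively oriented; the radii $R>r>0$ are arbitrary). Let $$\mathrm{Ai}(x)=\frac1\pi\int_0^\infty\cos\Big(\frac{s^3}{3}+sx\Big)\,ds,\qquad x\in\mathbb{R},$$ be the Airy function, the integral being understood as $\lim_{T\to\infty}\int_0^T$, and let $$K_{\mathrm{Airy}}(x,y)=\frac{\mathrm{Ai}(x)\,\mathrm{Ai}'(y)-\mathrm{Ai}'(x)\,\mathrm{Ai}(y)}{x-y}\quad(x\neq y),\qquad K_{\mathrm{Airy}}(x,x)=\mathrm{Ai}'(x)^2-x\,\mathrm{Ai}(x)^2 ,$$ be the Airy kernel (the diagonal value being the one obtained by continuity). Then the integral defining $\mathrm{Ai}(x)$ converges for every $x\in\mathbb{R}$, the function $\mathrm{Ai}$ is differentiable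 on $\mathbb{R}$, and the following holds. Let $R>r>0$ and $x,y\in\mathbb{R}$, and let $X(\xi),Y(\xi)\in\mathbb{Z}+\tfrac12$ be any functions of $\xi$ such that, as $\xi\to\infty$, $$\frac{X(\xi)-2\sqrt\xi}{\xi^{1/6}}\to x,\qquad \frac{Y(\xi)-2\sqrt\xi}{\xi^{1/6}}\to y .$$ Then $$\xi^{1/6}\,K_{\mathrm{Bessel}}\big(X(\xi),Y(\xi);\xi\big)\to K_{\mathrm{Airy}}(x,y),\qquad \xi\to\infty .$$ -/

import Mathlib

/-- The Airy function `Ai(x) = (1/π) ∫₀^∞ cos (s³/3 + s x) ds`. The integral converges only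
conditionally, so it is the limit of the integrals over `[0, T]` as `T → ∞`. -/
noncomputable def airyAi (x : ℝ) : ℝ :=
  (1 / Real.pi) *
    Filter.limUnder Filter.atTop (fun T : ℝ => ∫ s in (0 : ℝ)..T, Real.cos (s ^ 3 / 3 + s * x))

/-- The Airy kernel `(Ai(x) Ai'(y) - Ai'(x) Ai(y)) / (x - y)`, with its value by continuity
`Ai'(x)² - x Ai(x)²` on the diagonal. -/
noncomputable def airyKernel (x y : ℝ) : ℝ :=
  if x = y then deriv airyAi x ^ 2 - x * airyAi x ^ 2
  else (airyAi x * deriv airyAi y - deriv airyAi x * airyAi y) / (x - y)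

/-- The discrete Bessel kernel `K(x, y; ξ)` at the half-integers `x = m + 1/2`, `y = n + 1/2`:
the double contour integral
`(2πi)⁻² ∬ exp (√ξ (z - z⁻¹ - w + w⁻¹)) / (z - w) · dz dw / (z ^ (x + 1/2) w ^ (-y + 1/2))`
over the positively oriented circles `|z| = R` and `|w| = r`, to be used with `0 < r < R`.
Here `z ^ (x + 1/2) = z ^ (m + 1)` and `w ^ (-y + 1/2) = w ^ (-n)`. -/
noncomputable def discreteBesselKernel (R r ξ : ℝ) (m n : ℤ) : ℂ :=
  (1 / (2 * (Real.pi : ℂ) * Complex.I) ^ 2) *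
    ∮ z in C(0, R), ∮ w in C(0, r),
      Complex.exp ((Real.sqrt ξ : ℂ) * (z - z⁻¹ - w + w⁻¹)) / (z - w) *
        (1 / (z ^ (m + 1) * w ^ (-n)))

/-!
The Airy function is rewritten as the absolutely convergent contour integral
`2π Ai(x) = ∫ exp (a³ / 3 - x a) dt` over `a = 1 + i t`; the defining integral, which lives on the
imaginary axis, is moved there by Cauchy's theorem (`tendsto_intervalIntegral_imaginaryAxis`). On
this line the integrand has Gaussian decay, so one may differentiate under the integral sign
(`hasDerivAt_airyMoment`) and integrate by parts, which gives `Ai'' = x Ai` (`airyMoment_two`).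

The Airy kernel has the double integral representation
`4π² K(x, y) = ∬ exp (a³ / 3 - x a) exp (b³ / 3 - y b) / (a + b)` (`airyDouble_eq_airyKernel`).
For `x ≠ y` this is an integration by parts with the operator `∂_a - ∂_b`, which annihilates
`1 / (a + b)`. On the diagonal it follows by continuity, through the derivative of
`(x - y) K(x, y)` in `y` at `y = x`.

The Bessel kernel does not depend on its radii (`discreteBesselKernel_radius_indep`), so with
`h = ξ ^ (-1 / 6)` the contours may be taken to be `z = exp (h a)`, `w = exp (-h b)`, where
`a = 1 + i t`, `b = 1 + i s` and `|t|, |s| ≤ π / h`. There `ξ ^ (1 / 6) K_Bessel` is exactly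
`1 / 4π²` times the integral of
`exp (2 h⁻³ (sinh (h a) - h a) - X a) * exp (2 h⁻³ (sinh (h b) - h b) - Y b)` times
`h / (2 sinh (h (a + b) / 2))`,
with `X`, `Y` the rescaled positions (`discreteBesselKernel_eq_setIntegral`). The integrand
converges pointwise to that of the Airy kernel and has a Gaussian bound uniform in `h`
(`norm_besselEdge_le`), so dominated convergence concludes.
-/

open Filter Topology MeasureTheory

/-! ### The Airy function on the line `Re a = 1` -/

/-- The vertical line `Re a = 1`, parametrized by height. -/
noncomputable def airyLine (t : ℝ) : ℂ := 1 + t * Complex.I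

/-- The integrand `exp (a³ / 3 - x a)` of the contour representation of the Airy function, at the
point `a = 1 + i t`. -/
noncomputable def airyExp (x t : ℝ) : ℂ :=
  Complex.exp (airyLine t ^ 3 / 3 - x * airyLine t)

/-- The moments `∫ aᵏ exp (a³ / 3 - x a) dt` over the line `a = 1 + i t`. Up to the factor
`(-1)ᵏ / 2π` these are the derivatives of the Airy function. -/
noncomputable def airyMoment (k : ℕ) (x : ℝ) : ℂ :=
  ∫ t : ℝ, airyLine t ^ k * airyExp x t

@[simp] lemma airyLine_re (t : ℝ) : (airyLine t).re = 1 := by simp [airyLine]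

@[simp] lemma airyLine_im (t : ℝ) : (airyLine t).im = t := by simp [airyLine]

@[fun_prop] lemma continuous_airyLine : Continuous airyLine := by
  unfold airyLine; fun_prop

@[fun_prop] lemma continuous_airyExp (x : ℝ) : Continuous (airyExp x) := by
  unfold airyExp; fun_prop

lemma hasDerivAt_airyLine (t : ℝ) : HasDerivAt airyLine Complex.I t := by
  unfold airyLine
  simpa using ((Complex.ofRealCLM.hasDerivAt (x := t)).mul_const Complex.I).const_add (1 : ℂ)

lemma norm_airyLine_le (t : ℝ) : ‖airyLine t‖ ≤ 1 + |t| := by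
  refine (Complex.norm_le_abs_re_add_abs_im _).trans ?_
  simp

lemma norm_exp_cube_sub (c x t : ℝ) :
    ‖Complex.exp (((c : ℂ) + t * Complex.I) ^ 3 / 3 - x * (c + t * Complex.I))‖ =
      Real.exp (c ^ 3 / 3 - c * t ^ 2 - x * c) := by
  rw [Complex.norm_exp]
  congr 1
  have : ((c : ℂ) + t * Complex.I) ^ 3 / 3 - x * (c + t * Complex.I) =
      ((c ^ 3 / 3 - c * t ^ 2 - x * c : ℝ) : ℂ)
        + ((c ^ 2 * t - t ^ 3 / 3 - x * t : ℝ) : ℂ) * Complex.I := by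
    push_cast
    linear_combination (c * t ^ 2 + t ^ 3 / 3 * Complex.I) * Complex.I_sq
  rw [this]
  simp [-Complex.ofReal_add, -Complex.ofReal_sub, -Complex.ofReal_mul, -Complex.ofReal_pow]

lemma norm_airyExp (x t : ℝ) : ‖airyExp x t‖ = Real.exp (1 / 3 - t ^ 2 - x) := by
  have := norm_exp_cube_sub 1 x t
  simpa [airyExp, airyLine] using this

lemma one_add_abs_pow_mul_exp_le (k : ℕ) (t : ℝ) :
    (1 + |t|) ^ k * Real.exp (-t ^ 2) ≤ Real.exp (k ^ 2 / 2) * Real.exp (-(1 / 2) * t ^ 2) := by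
  have h1 : (1 + |t|) ^ k ≤ Real.exp (k * |t|) := by
    rw [Real.exp_nat_mul]
    gcongr
    linarith [Real.add_one_le_exp |t|]
  calc (1 + |t|) ^ k * Real.exp (-t ^ 2) ≤ Real.exp (k * |t|) * Real.exp (-t ^ 2) := by gcongr
    _ ≤ _ := by
      rw [← Real.exp_add, ← Real.exp_add, Real.exp_le_exp]
      nlinarith [sq_nonneg ((k : ℝ) - |t|), sq_abs t]

lemma norm_airyLine_pow_mul_airyExp_le (k : ℕ) (x t : ℝ) :
    ‖airyLine t ^ k * airyExp x t‖ ≤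
      Real.exp (1 / 3 - x + k ^ 2 / 2) * Real.exp (-(1 / 2) * t ^ 2) := by
  have hn : Real.exp (1 / 3 - t ^ 2 - x) = Real.exp (1 / 3 - x) * Real.exp (-t ^ 2) := by
    rw [← Real.exp_add]; ring_nf
  rw [norm_mul, norm_pow, norm_airyExp, hn]
  calc ‖airyLine t‖ ^ k * (Real.exp (1 / 3 - x) * Real.exp (-t ^ 2))
      ≤ (1 + |t|) ^ k * (Real.exp (1 / 3 - x) * Real.exp (-t ^ 2)) := by
        gcongr; exact norm_airyLine_le t
    _ = Real.exp (1 / 3 - x) * ((1 + |t|) ^ k * Real.exp (-t ^ 2)) := by ring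
    _ ≤ Real.exp (1 / 3 - x) * (Real.exp (k ^ 2 / 2) * Real.exp (-(1 / 2) * t ^ 2)) := by
        exact mul_le_mul_of_nonneg_left (one_add_abs_pow_mul_exp_le k t) (Real.exp_nonneg _)
    _ = _ := by rw [← mul_assoc, ← Real.exp_add]

lemma integrable_gaussian_half : Integrable fun t : ℝ => Real.exp (-(1 / 2) * t ^ 2) :=
  integrable_exp_neg_mul_sq (by norm_num)

lemma integrable_airyLine_pow_mul_airyExp (k : ℕ) (x : ℝ) :
    Integrable fun t => airyLine t ^ k * airyExp x t :=
  (integrable_gaussian_half.const_mul _).mono' (by fun_prop)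
    (.of_forall (norm_airyLine_pow_mul_airyExp_le k x))

lemma integrable_airyExp (x : ℝ) : Integrable (airyExp x) := by
  simpa using integrable_airyLine_pow_mul_airyExp 0 x

lemma hasDerivAt_airyMoment (k : ℕ) (x : ℝ) :
    HasDerivAt (airyMoment k) (-airyMoment (k + 1) x) x := by
  have key := (hasDerivAt_integral_of_dominated_loc_of_deriv_le (𝕜 := ℝ) (μ := volume)
    (F := fun x t => airyLine t ^ k * airyExp x t)
    (F' := fun x t => -(airyLine t ^ (k + 1) * airyExp x t))
    (bound := fun t => Real.exp (1 / 3 - (x - 1) + (k + 1 : ℕ) ^ 2 / 2) *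
      Real.exp (-(1 / 2) * t ^ 2)) (s := Metric.ball x 1) (x₀ := x)
    (Metric.ball_mem_nhds x one_pos) (.of_forall fun y => by fun_prop)
    (integrable_airyLine_pow_mul_airyExp k x) (by fun_prop)
    (.of_forall fun t y hy => ?_) (integrable_gaussian_half.const_mul _)
    (.of_forall fun t y _ => ?_)).2
  · rw [integral_neg] at key
    exact key
  · rw [norm_neg]
    refine (norm_airyLine_pow_mul_airyExp_le (k + 1) y t).trans ?_
    have := (abs_lt.1 (Real.dist_eq y x ▸ Metric.mem_ball.1 hy)).1
    gcongr
    linarith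
  · have h1 : HasDerivAt (fun y : ℝ => airyLine t ^ 3 / 3 - (y : ℂ) * airyLine t)
        (-airyLine t) y := by
      simpa using
        ((Complex.ofRealCLM.hasDerivAt (x := y)).mul_const (airyLine t)).const_sub
          (airyLine t ^ 3 / 3)
    have h2 := (h1.cexp).const_mul (airyLine t ^ k)
    refine h2.congr_deriv ?_
    unfold airyExp
    ring

lemma hasDerivAt_airyExp (x t : ℝ) :
    HasDerivAt (airyExp x) (Complex.I * ((airyLine t ^ 2 - x) * airyExp x t)) t := by
  have h := ((((hasDerivAt_airyLine t).pow 3).div_const 3).sub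
    ((hasDerivAt_airyLine t).const_mul (x : ℂ))).cexp
  refine h.congr_deriv ?_
  simp only [airyExp, Pi.pow_apply, Pi.sub_apply]
  push_cast
  ring

lemma integrable_airyLine_sq_sub_mul_airyExp (x : ℝ) :
    Integrable fun t => (airyLine t ^ 2 - x) * airyExp x t := by
  simp only [sub_mul]
  exact (integrable_airyLine_pow_mul_airyExp 2 x).sub ((integrable_airyExp x).const_mul (x : ℂ))

/-- The Airy equation `Ai'' = x Ai`: the integral of `d/dt exp (a³ / 3 - x a)` vanishes. -/
lemma airyMoment_two (x : ℝ) : airyMoment 2 x = x * airyMoment 0 x := by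
  have h := integral_eq_zero_of_hasDerivAt_of_integrable (hasDerivAt_airyExp x)
    ((integrable_airyLine_sq_sub_mul_airyExp x).const_mul _) (integrable_airyExp x)
  rw [integral_const_mul] at h
  have h2 := (mul_eq_zero.1 h).resolve_left Complex.I_ne_zero
  simp only [sub_mul] at h2
  rw [integral_sub (integrable_airyLine_pow_mul_airyExp 2 x)
    ((integrable_airyExp x).const_mul (x : ℂ)), integral_const_mul, sub_eq_zero] at h2
  simpa [airyMoment] using h2

/-- Cauchy's theorem on the rectangle with vertices `± i T`, `1 ± i T`: on the horizontal sides the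
integrand at real part `c` is bounded by a constant times `exp (-c T²)`, whose integral over
`c ∈ [0, 1]` is `O (1 / T²)`. -/
lemma tendsto_intervalIntegral_imaginaryAxis (x : ℝ) :
    Tendsto (fun T : ℝ => ∫ s in (-T)..T,
      Complex.exp ((s * Complex.I) ^ 3 / 3 - x * (s * Complex.I)))
      atTop (𝓝 (airyMoment 0 x)) := by
  set f : ℂ → ℂ := fun a => Complex.exp (a ^ 3 / 3 - x * a) with hf
  have hline : Tendsto (fun T : ℝ => ∫ t in (-T)..T, airyExp x t) atTop (𝓝 (airyMoment 0 x)) := by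
    have := intervalIntegral_tendsto_integral (integrable_airyExp x) tendsto_neg_atTop_atBot
      tendsto_id
    simpa [airyMoment] using this
  -- the horizontal sides, at height `σ T` with `σ = ± 1`
  have hside : ∀ σ : ℝ, σ ^ 2 = 1 → Tendsto (fun T : ℝ =>
      ∫ c in (0 : ℝ)..1, f (c + ((σ * T : ℝ) : ℂ) * Complex.I)) atTop (𝓝 0) := by
    intro σ hσ
    have hmain : Tendsto (fun T : ℝ => Real.exp (1 / 3 + |x|) * (1 / T ^ 2)) atTop (𝓝 0) := by
      have : Tendsto (fun T : ℝ => 1 / T ^ 2) atTop (𝓝 0) := by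
        simp only [one_div]
        exact (tendsto_pow_atTop (α := ℝ) two_ne_zero).inv_tendsto_atTop
      simpa using this.const_mul (Real.exp (1 / 3 + |x|))
    refine squeeze_zero_norm' ?_ hmain
    filter_upwards [eventually_gt_atTop 0] with T hT
    have hT2 : T ^ 2 ≠ 0 := by positivity
    have hint : ∫ c in (0 : ℝ)..1, Real.exp (1 / 3 + |x|) * Real.exp (-T ^ 2 * c) ≤
        Real.exp (1 / 3 + |x|) * (1 / T ^ 2) := by
      rw [intervalIntegral.integral_const_mul]
      gcongr
      rw [intervalIntegral.integral_comp_mul_left (fun u => Real.exp u) (neg_ne_zero.2 hT2),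
        integral_exp]
      simp only [mul_one, mul_zero, Real.exp_zero, smul_eq_mul]
      have : 0 ≤ (T ^ 2)⁻¹ * Real.exp (-T ^ 2) := by positivity
      rw [inv_neg, one_div]
      linarith
    refine le_trans ?_ hint
    refine intervalIntegral.norm_integral_le_of_norm_le zero_le_one
      (.of_forall fun c hc => ?_) (Continuous.intervalIntegrable (by fun_prop) _ _)
    rw [hf]
    simp only
    rw [norm_exp_cube_sub, ← Real.exp_add, Real.exp_le_exp, mul_pow, hσ]
    have hc3 : c ^ 3 ≤ 1 := pow_le_one₀ hc.1.le hc.2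
    have : -(x * c) ≤ |x| := by
      calc -(x * c) ≤ |x * c| := neg_le_abs _
        _ = |x| * c := by rw [abs_mul, abs_of_pos hc.1]
        _ ≤ |x| * 1 := by gcongr; exact hc.2
        _ = |x| := mul_one _
    linarith
  have hrect : ∀ T : ℝ, (∫ s in (-T)..T, Complex.exp ((s * Complex.I) ^ 3 / 3
      - x * (s * Complex.I))) = (∫ t in (-T)..T, airyExp x t)
        - Complex.I * (∫ c in (0 : ℝ)..1, f (c + (((-1) * T : ℝ) : ℂ) * Complex.I))
        + Complex.I * (∫ c in (0 : ℝ)..1, f (c + ((1 * T : ℝ) : ℂ) * Complex.I)) := by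
    intro T
    have h := Complex.integral_boundary_rect_eq_zero_of_differentiableOn f
      (((-T : ℝ) : ℂ) * Complex.I) (1 + (T : ℂ) * Complex.I)
      (by rw [hf]; exact Differentiable.differentiableOn (by fun_prop))
    simp only [Complex.mul_re, Complex.ofReal_re, Complex.I_re, mul_zero, Complex.ofReal_im,
      Complex.I_im, mul_one, sub_self, Complex.add_re, Complex.one_re, add_zero, Complex.mul_im,
      Complex.add_im, Complex.one_im, zero_add, Complex.ofReal_zero, Complex.ofReal_one,
      smul_eq_mul] at h
    have e1 : (∫ y in (-T)..T, f (1 + y * Complex.I)) = ∫ t in (-T)..T, airyExp x t := rfl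
    have e2 : (∫ y in (-T)..T, f (y * Complex.I)) = ∫ s in (-T)..T,
      Complex.exp ((s * Complex.I) ^ 3 / 3 - x * (s * Complex.I)) := rfl
    rw [e1, e2] at h
    rw [neg_one_mul, one_mul]
    linear_combination (Complex.I) * h + ((∫ s in (-T)..T, Complex.exp ((s * Complex.I) ^ 3 / 3
      - x * (s * Complex.I))) - (∫ t in (-T)..T, airyExp x t)) * Complex.I_sq
  simp only [hrect]
  simpa using (hline.sub ((hside (-1) (by norm_num)).const_mul Complex.I)).add
    ((hside 1 (by norm_num)).const_mul Complex.I)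

lemma intervalIntegral_imaginaryAxis_eq (x T : ℝ) :
    (∫ s in (-T)..T, Complex.exp ((s * Complex.I) ^ 3 / 3 - x * (s * Complex.I))) =
      ((2 * ∫ s in (0 : ℝ)..T, Real.cos (s ^ 3 / 3 + s * x) : ℝ) : ℂ) := by
  have hc : ∀ a b : ℝ, IntervalIntegrable (fun s : ℝ => Complex.exp ((s * Complex.I) ^ 3 / 3
      - x * (s * Complex.I))) volume a b :=
    fun a b => Continuous.intervalIntegrable (by fun_prop) _ _
  have hneg : (∫ s in (-T)..(0 : ℝ), Complex.exp ((s * Complex.I) ^ 3 / 3 - x * (s * Complex.I)))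
      = ∫ s in (0 : ℝ)..T, Complex.exp ((((-s : ℝ) : ℂ) * Complex.I) ^ 3 / 3
        - x * (((-s : ℝ) : ℂ) * Complex.I)) := by
    rw [intervalIntegral.integral_comp_neg (fun s : ℝ => Complex.exp ((s * Complex.I) ^ 3 / 3
      - x * (s * Complex.I))), neg_zero]
  rw [← intervalIntegral.integral_add_adjacent_intervals (hc (-T) 0) (hc 0 T), hneg,
    ← intervalIntegral.integral_add (Continuous.intervalIntegrable (by fun_prop) _ _) (hc 0 T),
    ← intervalIntegral.integral_const_mul, ← intervalIntegral.integral_ofReal]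
  refine intervalIntegral.integral_congr fun s _ => ?_
  push_cast
  rw [Complex.two_cos]
  congr 2
  · linear_combination (-(s : ℂ) ^ 3 / 3 * Complex.I) * Complex.I_sq
  · linear_combination ((s : ℂ) ^ 3 / 3 * Complex.I) * Complex.I_sq

lemma tendsto_airyIntegral (x : ℝ) :
    Tendsto (fun T : ℝ => ∫ s in (0 : ℝ)..T, Real.cos (s ^ 3 / 3 + s * x))
      atTop (𝓝 ((airyMoment 0 x).re / 2)) := by
  have h := (Complex.continuous_re.tendsto _).comp (tendsto_intervalIntegral_imaginaryAxis x)
  refine (h.div_const 2).congr fun T => ?_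
  simp only [Function.comp_apply]
  rw [intervalIntegral_imaginaryAxis_eq, Complex.ofReal_re]
  ring

lemma airyMoment_zero_im (x : ℝ) : (airyMoment 0 x).im = 0 := by
  have h := (Complex.continuous_im.tendsto _).comp (tendsto_intervalIntegral_imaginaryAxis x)
  refine tendsto_nhds_unique h (tendsto_const_nhds.congr fun T => ?_)
  simp only [Function.comp_apply]
  rw [intervalIntegral_imaginaryAxis_eq, Complex.ofReal_im]

/-- The defining improper integral of the Airy function converges. -/
lemma tendsto_airyAi (x : ℝ) :
    Tendsto (fun T : ℝ => (1 / Real.pi) * ∫ s in (0 : ℝ)..T, Real.cos (s ^ 3 / 3 + s * x))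
      atTop (𝓝 (airyAi x)) := by
  unfold airyAi
  rw [(tendsto_airyIntegral x).limUnder_eq]
  exact (tendsto_airyIntegral x).const_mul _

lemma airyMoment_zero (x : ℝ) : airyMoment 0 x = 2 * Real.pi * airyAi x := by
  have h : airyAi x = 1 / Real.pi * ((airyMoment 0 x).re / 2) := by
    unfold airyAi
    rw [(tendsto_airyIntegral x).limUnder_eq]
  have hpi := Real.pi_ne_zero
  apply Complex.ext
  · have : (2 * Real.pi * airyAi x : ℂ) = ((2 * Real.pi * airyAi x : ℝ) : ℂ) := by push_cast; rfl
    rw [this, Complex.ofReal_re, h]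
    field_simp
  · have : (2 * Real.pi * airyAi x : ℂ) = ((2 * Real.pi * airyAi x : ℝ) : ℂ) := by push_cast; rfl
    rw [this, Complex.ofReal_im, airyMoment_zero_im]

lemma differentiable_airyAi : Differentiable ℝ airyAi := by
  intro x
  have h : airyAi = fun y => (airyMoment 0 y).re / (2 * Real.pi) := by
    funext y
    rw [airyMoment_zero]
    have : (2 * Real.pi * airyAi y : ℂ) = ((2 * Real.pi * airyAi y : ℝ) : ℂ) := by push_cast; rfl
    rw [this, Complex.ofReal_re]
    field_simp
  rw [h]
  exact ((Complex.reCLM.hasFDerivAt.comp_hasDerivAt x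
    (hasDerivAt_airyMoment 0 x)).differentiableAt).div_const _

lemma airyMoment_one (x : ℝ) : airyMoment 1 x = -(2 * Real.pi * (deriv airyAi x : ℝ)) := by
  have h1 := hasDerivAt_airyMoment 0 x
  have h2 : HasDerivAt (airyMoment 0) (2 * Real.pi * (deriv airyAi x : ℝ)) x := by
    rw [show airyMoment 0 = fun y => (2 * Real.pi * airyAi y : ℂ) from funext airyMoment_zero]
    exact ((differentiable_airyAi x).hasDerivAt.ofReal_comp).const_mul _
  rw [h2.unique h1, zero_add, neg_neg]

/-! ### A double integral for the Airy kernel -/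

/-- The double integral `∬ exp (a³ / 3 - x a) exp (b³ / 3 - y b) / (a + b)` over `a = 1 + i t`,
`b = 1 + i s`, which is `4 π²` times the Airy kernel. -/
noncomputable def airyDouble (x y : ℝ) : ℂ :=
  ∫ p : ℝ × ℝ, airyExp x p.1 * airyExp y p.2 * (airyLine p.1 + airyLine p.2)⁻¹

lemma one_le_norm_airyLine_add (t s : ℝ) : 1 ≤ ‖airyLine t + airyLine s‖ := by
  have h := Complex.re_le_norm (airyLine t + airyLine s)
  simp only [Complex.add_re, airyLine_re] at h
  linarith

lemma airyLine_add_ne_zero (t s : ℝ) : airyLine t + airyLine s ≠ 0 :=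
  norm_pos_iff.1 (one_pos.trans_le (one_le_norm_airyLine_add t s))

lemma norm_airyLine_add_inv_le (t s : ℝ) : ‖(airyLine t + airyLine s)⁻¹‖ ≤ 1 := by
  rw [norm_inv]
  exact inv_le_one_of_one_le₀ (one_le_norm_airyLine_add t s)

@[fun_prop] lemma continuous_airyLine_add_inv :
    Continuous fun p : ℝ × ℝ => (airyLine p.1 + airyLine p.2)⁻¹ :=
  Continuous.inv₀ (by fun_prop) fun p => airyLine_add_ne_zero p.1 p.2

lemma integrable_mul_airyLine_add_inv_pow {u v : ℝ → ℂ} (hu : Integrable u) (hv : Integrable v)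
    (j : ℕ) :
    Integrable fun p : ℝ × ℝ => u p.1 * v p.2 * (airyLine p.1 + airyLine p.2)⁻¹ ^ j := by
  have h := hu.mul_prod hv
  refine h.mono (h.aestronglyMeasurable.mul
    (Continuous.aestronglyMeasurable (by fun_prop))) (.of_forall fun p => ?_)
  rw [norm_mul, norm_pow]
  exact mul_le_of_le_one_right (norm_nonneg _)
    (pow_le_one₀ (norm_nonneg _) (norm_airyLine_add_inv_le _ _))

lemma integrable_mul_airyLine_add_inv {u v : ℝ → ℂ} (hu : Integrable u) (hv : Integrable v) :
    Integrable fun p : ℝ × ℝ => u p.1 * v p.2 * (airyLine p.1 + airyLine p.2)⁻¹ := by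
  simpa using integrable_mul_airyLine_add_inv_pow hu hv 1

/-- Integration by parts in the first variable of `airyDouble`. -/
lemma integral_airyExp_ibp (x y : ℝ) :
    ∫ p : ℝ × ℝ, ((airyLine p.1 ^ 2 - x) * airyExp x p.1) * airyExp y p.2 *
        (airyLine p.1 + airyLine p.2)⁻¹ =
      ∫ p : ℝ × ℝ, airyExp x p.1 * airyExp y p.2 * (airyLine p.1 + airyLine p.2)⁻¹ ^ 2 := by
  have hi1 := integrable_mul_airyLine_add_inv (integrable_airyLine_sq_sub_mul_airyExp x)
    (integrable_airyExp y)
  have hi2 := integrable_mul_airyLine_add_inv_pow (integrable_airyExp x) (integrable_airyExp y) 2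
  rw [← sub_eq_zero, ← integral_sub hi1 hi2]
  have hi := hi1.sub hi2
  rw [Measure.volume_eq_prod] at hi ⊢
  refine (integral_prod_symm _ hi).trans ?_
  refine integral_eq_zero_of_ae ?_
  filter_upwards [hi.prod_left_ae] with s hs
  have hd : ∀ t, HasDerivAt
      (fun t => airyExp x t * airyExp y s * (airyLine t + airyLine s)⁻¹)
      (Complex.I * (((airyLine t ^ 2 - x) * airyExp x t) * airyExp y s *
        (airyLine t + airyLine s)⁻¹ -
        airyExp x t * airyExp y s * (airyLine t + airyLine s)⁻¹ ^ 2)) t := by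
    intro t
    have h := ((hasDerivAt_airyExp x t).mul_const (airyExp y s)).mul
      (((hasDerivAt_airyLine t).add_const (airyLine s)).inv (airyLine_add_ne_zero t s))
    refine h.congr_deriv ?_
    simp only [Pi.inv_apply]
    have := airyLine_add_ne_zero t s
    field_simp
    ring
  -- the derivative has integral zero because its primitive is integrable as well
  have hint : Integrable fun t => airyExp x t * airyExp y s * (airyLine t + airyLine s)⁻¹ := by
    have h := (integrable_airyExp x).mul_const (airyExp y s)
    refine h.mono (h.aestronglyMeasurable.mul ?_) (.of_forall fun t => ?_)
    · exact (Continuous.inv₀ (by fun_prop)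
        fun t => airyLine_add_ne_zero t s).aestronglyMeasurable
    · rw [norm_mul _ (_)⁻¹]
      exact mul_le_of_le_one_right (norm_nonneg _) (norm_airyLine_add_inv_le _ _)
  have h0 := integral_eq_zero_of_hasDerivAt_of_integrable hd (hs.const_mul _) hint
  rw [integral_const_mul] at h0
  exact (mul_eq_zero.1 h0).resolve_left Complex.I_ne_zero

/-- The Christoffel–Darboux type identity: `∂_a - ∂_b` annihilates `1 / (a + b)`, hence the
integral of `(∂_a - ∂_b) (exp (a³ / 3 - x a) exp (b³ / 3 - y b)) / (a + b)` vanishes. -/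
lemma sub_mul_airyDouble (x y : ℝ) :
    ((x : ℂ) - y) * airyDouble x y =
      airyMoment 1 x * airyMoment 0 y - airyMoment 0 x * airyMoment 1 y := by
  have h1 := integral_airyExp_ibp x y
  have h2 : ∫ p : ℝ × ℝ, airyExp x p.1 * ((airyLine p.2 ^ 2 - y) * airyExp y p.2) *
        (airyLine p.1 + airyLine p.2)⁻¹ =
      ∫ p : ℝ × ℝ, airyExp x p.1 * airyExp y p.2 * (airyLine p.1 + airyLine p.2)⁻¹ ^ 2 := by
    have hswap : ∀ f : ℝ × ℝ → ℂ, ∫ p : ℝ × ℝ, f p = ∫ p : ℝ × ℝ, f p.swap :=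
      fun f => (integral_prod_swap f).symm
    have h := integral_airyExp_ibp y x
    rw [hswap, hswap (fun p : ℝ × ℝ => airyExp y p.1 * airyExp x p.2 *
      (airyLine p.1 + airyLine p.2)⁻¹ ^ 2)] at h
    simp only [Prod.fst_swap, Prod.snd_swap] at h
    simpa only [add_comm, mul_comm] using h
  have hA : ∀ k l : ℕ, ∀ x y : ℝ, airyMoment k x * airyMoment l y =
      ∫ p : ℝ × ℝ, (airyLine p.1 ^ k * airyExp x p.1) * (airyLine p.2 ^ l * airyExp y p.2) := by
    intro k l x y
    exact (integral_prod_mul (μ := volume) (ν := volume) (fun t => airyLine t ^ k * airyExp x t)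
      (fun t => airyLine t ^ l * airyExp y t)).symm
  have hI : ∀ k l : ℕ, Integrable fun p : ℝ × ℝ =>
      (airyLine p.1 ^ k * airyExp x p.1) * (airyLine p.2 ^ l * airyExp y p.2) := fun k l =>
    (integrable_airyLine_pow_mul_airyExp k x).mul_prod
    (integrable_airyLine_pow_mul_airyExp l y)
  rw [hA, hA, ← integral_sub (hI 1 0) (hI 0 1), airyDouble, ← integral_const_mul, ← sub_eq_zero]
  have hd := integrable_mul_airyLine_add_inv (integrable_airyExp x) (integrable_airyExp y)
  refine (integral_sub (hd.const_mul _) ((hI 1 0).sub (hI 0 1))).symm.trans ?_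
  rw [← h2, ← sub_eq_zero, ← integral_sub
    (integrable_mul_airyLine_add_inv (integrable_airyLine_sq_sub_mul_airyExp x)
      (integrable_airyExp y))
    (integrable_mul_airyLine_add_inv (integrable_airyExp x)
      (integrable_airyLine_sq_sub_mul_airyExp y))] at h1
  rw [← neg_eq_zero, ← integral_neg, ← h1]
  refine integral_congr_ae (.of_forall fun p => ?_)
  have := airyLine_add_ne_zero p.1 p.2
  simp only [Pi.sub_apply]
  field_simp
  ring

lemma continuousAt_airyDouble (x y : ℝ) : ContinuousAt (airyDouble x) y := by
  refine continuousAt_of_dominated (bound := fun p : ℝ × ℝ =>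
    ‖airyExp x p.1‖ * (Real.exp (1 / 3 - (y - 1) + (0 : ℕ) ^ 2 / 2) *
      Real.exp (-(1 / 2) * p.2 ^ 2)))
    (.of_forall fun z => Continuous.aestronglyMeasurable (by fun_prop)) ?_ ?_ ?_
  · filter_upwards [Metric.ball_mem_nhds y one_pos] with z hz
    refine .of_forall fun p => ?_
    have hz' := (abs_lt.1 (Real.dist_eq z y ▸ Metric.mem_ball.1 hz)).1
    have hb := norm_airyLine_pow_mul_airyExp_le 0 z p.2
    rw [pow_zero, one_mul] at hb
    rw [norm_mul, norm_mul]
    refine (mul_le_of_le_one_right (by positivity) (norm_airyLine_add_inv_le _ _)).trans ?_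
    refine mul_le_mul_of_nonneg_left (hb.trans ?_) (norm_nonneg _)
    gcongr
    linarith
  · exact (integrable_airyExp x).norm.mul_prod (integrable_gaussian_half.const_mul _)
  · refine .of_forall fun p => ?_
    unfold airyExp
    fun_prop

lemma hasDerivAt_deriv_airyAi (x : ℝ) : HasDerivAt (deriv airyAi) (x * airyAi x) x := by
  have h : deriv airyAi = fun y => -(airyMoment 1 y).re / (2 * Real.pi) := by
    funext y
    rw [airyMoment_one]
    have : (-(2 * Real.pi * (deriv airyAi y : ℝ)) : ℂ) =
      ((-(2 * Real.pi * deriv airyAi y) : ℝ) : ℂ) := by push_cast; rfl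
    rw [this, Complex.ofReal_re]
    have := Real.pi_ne_zero
    field_simp
  rw [h]
  refine (((Complex.reCLM.hasFDerivAt.comp_hasDerivAt x
    (hasDerivAt_airyMoment 1 x)).neg).div_const _).congr_deriv ?_
  rw [show 1 + 1 = 2 from rfl, airyMoment_two, airyMoment_zero]
  have : (-((x : ℂ) * (2 * Real.pi * airyAi x))) =
    ((-(x * (2 * Real.pi * airyAi x)) : ℝ) : ℂ) := by push_cast; rfl
  rw [this, Complex.reCLM_apply, Complex.ofReal_re]
  have := Real.pi_ne_zero
  field_simp

lemma sub_mul_airyDouble_eq (x y : ℝ) :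
    ((x : ℂ) - y) * airyDouble x y = 4 * (Real.pi : ℂ) ^ 2 *
      ((airyAi x * deriv airyAi y - deriv airyAi x * airyAi y : ℝ) : ℂ) := by
  rw [sub_mul_airyDouble, airyMoment_zero, airyMoment_zero, airyMoment_one, airyMoment_one]
  push_cast
  ring

/-- On the diagonal the value follows by differentiating `(x - y) * airyDouble x y` in `y` at
`y = x`, with the help of the Airy equation. -/
theorem airyDouble_eq_airyKernel (x y : ℝ) :
    airyDouble x y = 4 * (Real.pi : ℂ) ^ 2 * (airyKernel x y : ℂ) := by
  by_cases hxy : x = y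
  · subst hxy
    have h1 : HasDerivAt (fun y : ℝ => ((x : ℂ) - y) * airyDouble x y) (-airyDouble x x) x := by
      rw [hasDerivAt_iff_tendsto_slope]
      refine ((continuousAt_airyDouble x x).tendsto.neg.mono_left nhdsWithin_le_nhds).congr' ?_
      filter_upwards [self_mem_nhdsWithin] with z hz
      have hz' : ((z : ℂ) - x) ≠ 0 := by
        rw [← Complex.ofReal_sub, Complex.ofReal_ne_zero]
        exact sub_ne_zero.2 hz
      simp only [slope, vsub_eq_sub, sub_self, zero_mul, sub_zero, Complex.real_smul,
        Complex.ofReal_inv, Complex.ofReal_sub]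
      field_simp
      ring
    have h2 : HasDerivAt (fun y : ℝ => ((x : ℂ) - y) * airyDouble x y)
        (4 * (Real.pi : ℂ) ^ 2 *
          ((airyAi x * (x * airyAi x) - deriv airyAi x * deriv airyAi x : ℝ) : ℂ)) x := by
      simp only [sub_mul_airyDouble_eq]
      exact ((((hasDerivAt_deriv_airyAi x).const_mul (airyAi x)).sub
        ((differentiable_airyAi x).hasDerivAt.const_mul (deriv airyAi x))).ofReal_comp).const_mul _
    have h := h1.unique h2
    rw [airyKernel, if_pos rfl, ← neg_inj, h]
    push_cast
    ring
  · have h0 : ((x : ℂ) - y) ≠ 0 := by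
      rw [← Complex.ofReal_sub, Complex.ofReal_ne_zero]
      exact sub_ne_zero.2 hxy
    rw [airyKernel, if_neg hxy]
    refine mul_left_cancel₀ h0 ((sub_mul_airyDouble_eq x y).trans ?_)
    push_cast
    field_simp

/-! ### Deformation of the contours -/

/-- The integrand of the discrete Bessel kernel, with `η = √ξ`. -/
noncomputable def besselIntegrand (η : ℝ) (m n : ℤ) (z w : ℂ) : ℂ :=
  Complex.exp ((η : ℂ) * (z - z⁻¹ - w + w⁻¹)) / (z - w) * (1 / (z ^ (m + 1) * w ^ (-n)))

lemma differentiableAt_besselIntegrand_left (η : ℝ) (m n : ℤ) {z w : ℂ} (hz : z ≠ 0)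
    (hw : w ≠ 0) (hzw : z ≠ w) :
    DifferentiableAt ℂ (fun z => besselIntegrand η m n z w) z := by
  unfold besselIntegrand
  have h1 : z - w ≠ 0 := sub_ne_zero.2 hzw
  have h2 : z ^ (m + 1) * w ^ (-n) ≠ 0 := mul_ne_zero (zpow_ne_zero _ hz) (zpow_ne_zero _ hw)
  have h3 : DifferentiableAt ℂ (fun z : ℂ => z ^ (m + 1)) z := differentiableAt_zpow.2 (.inl hz)
  have h4 : DifferentiableAt ℂ (fun z : ℂ => z⁻¹) z := differentiableAt_inv hz
  refine DifferentiableAt.mul (.div (.cexp ?_) ?_ ?_) (.div ?_ ?_ ?_)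
  all_goals first | assumption | fun_prop

lemma differentiableAt_besselIntegrand_right (η : ℝ) (m n : ℤ) {z w : ℂ} (hz : z ≠ 0)
    (hw : w ≠ 0) (hzw : z ≠ w) :
    DifferentiableAt ℂ (fun w => besselIntegrand η m n z w) w := by
  unfold besselIntegrand
  have h1 : z - w ≠ 0 := sub_ne_zero.2 hzw
  have h2 : z ^ (m + 1) * w ^ (-n) ≠ 0 := mul_ne_zero (zpow_ne_zero _ hz) (zpow_ne_zero _ hw)
  have h3 : DifferentiableAt ℂ (fun z : ℂ => z ^ (-n)) w := differentiableAt_zpow.2 (.inl hw)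
  have h4 : DifferentiableAt ℂ (fun z : ℂ => z⁻¹) w := differentiableAt_inv hw
  refine DifferentiableAt.mul (.div (.cexp ?_) ?_ ?_) (.div ?_ ?_ ?_)
  all_goals first | assumption | fun_prop

lemma continuousAt_besselIntegrand (η : ℝ) (m n : ℤ) {z w : ℂ} (hz : z ≠ 0)
    (hw : w ≠ 0) (hzw : z ≠ w) :
    ContinuousAt (fun p : ℂ × ℂ => besselIntegrand η m n p.1 p.2) (z, w) := by
  unfold besselIntegrand
  have h1 : z - w ≠ 0 := sub_ne_zero.2 hzw
  have h2 : z ^ (m + 1) * w ^ (-n) ≠ 0 := mul_ne_zero (zpow_ne_zero _ hz) (zpow_ne_zero _ hw)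
  have h3 : ContinuousAt (fun p : ℂ × ℂ => p.1 ^ (m + 1)) (z, w) :=
    continuousAt_fst.zpow₀ _ (.inl hz)
  have h4 : ContinuousAt (fun p : ℂ × ℂ => p.2 ^ (-n)) (z, w) :=
    continuousAt_snd.zpow₀ _ (.inl hw)
  have h5 : ContinuousAt (fun p : ℂ × ℂ => p.1⁻¹) (z, w) := continuousAt_fst.inv₀ hz
  have h6 : ContinuousAt (fun p : ℂ × ℂ => p.2⁻¹) (z, w) := continuousAt_snd.inv₀ hw
  refine ContinuousAt.mul (.div₀ (.cexp ?_) ?_ ?_) (.div₀ ?_ (h3.mul h4) ?_)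
  all_goals first | assumption | fun_prop

lemma ne_of_norm_lt_norm {z w : ℂ} (h : ‖w‖ < ‖z‖) : z ≠ w := fun e => by simp [e] at h

/-- Fubini's theorem for integrals over two circles. -/
lemma circleIntegral_circleIntegral_swap {F : ℂ → ℂ → ℂ} {R r : ℝ}
    (hF : Continuous fun p : ℝ × ℝ => F (circleMap 0 R p.1) (circleMap 0 r p.2)) :
    (∮ z in C(0, R), ∮ w in C(0, r), F z w) = ∮ w in C(0, r), ∮ z in C(0, R), F z w := by
  simp only [circleIntegral, ← intervalIntegral.integral_smul]
  rw [intervalIntegral_intervalIntegral_swap]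
  · simp only [smul_smul, mul_comm]
  · refine IntegrableOn.mono_set (t := Set.uIcc 0 (2 * Real.pi) ×ˢ Set.uIcc 0 (2 * Real.pi))
      (ContinuousOn.integrableOn_compact (isCompact_uIcc.prod isCompact_uIcc)
        (Continuous.continuousOn ?_)) (Set.prod_mono Set.uIoc_subset_uIcc Set.uIoc_subset_uIcc)
    simp only [deriv_circleMap]
    unfold Function.uncurry
    have h1 : Continuous fun p : ℝ × ℝ => circleMap 0 R p.1 * Complex.I :=
      ((continuous_circleMap 0 R).comp continuous_fst).mul continuous_const
    have h2 : Continuous fun p : ℝ × ℝ => circleMap 0 r p.2 * Complex.I :=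
      ((continuous_circleMap 0 r).comp continuous_snd).mul continuous_const
    exact h1.smul (h2.smul hF)

lemma continuous_besselIntegrand_circleMap (η : ℝ) (m n : ℤ) {R r : ℝ} (hr : 0 < r)
    (hrR : r < R) :
    Continuous fun p : ℝ × ℝ =>
      besselIntegrand η m n (circleMap 0 R p.1) (circleMap 0 r p.2) := by
  rw [continuous_iff_continuousAt]
  intro p
  have hR := hr.trans hrR
  exact (continuousAt_besselIntegrand η m n (circleMap_ne_center hR.ne')
    (circleMap_ne_center hr.ne')
    (ne_of_norm_lt_norm (by
      simpa [norm_circleMap_zero, abs_of_pos hr, abs_of_pos hR] using hrR))).comp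
    (f := fun p : ℝ × ℝ => (circleMap 0 R p.1, circleMap 0 r p.2))
    (Continuous.continuousAt (((continuous_circleMap 0 R).comp continuous_fst).prodMk
      ((continuous_circleMap 0 r).comp continuous_snd)))

lemma circleIntegral_besselIntegrand_right (η : ℝ) (m n : ℤ) {z : ℂ} {r r' : ℝ} (hr : 0 < r)
    (hrr : r ≤ r') (hz : r' < ‖z‖) :
    (∮ w in C(0, r'), besselIntegrand η m n z w) = ∮ w in C(0, r), besselIntegrand η m n z w := by
  have hd : ∀ w : ℂ, ‖w‖ ≤ r' → r ≤ ‖w‖ →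
      DifferentiableAt ℂ (fun w => besselIntegrand η m n z w) w := fun w h1 h2 =>
    differentiableAt_besselIntegrand_right η m n
      (norm_pos_iff.1 (hr.trans_le (hrr.trans hz.le)))
      (norm_pos_iff.1 (hr.trans_le h2)) (ne_of_norm_lt_norm (h1.trans_lt hz))
  refine Complex.circleIntegral_eq_of_differentiable_on_annulus_off_countable hr hrr
    Set.countable_empty (fun w hw => (hd w ?_ ?_).continuousAt.continuousWithinAt)
    (fun w hw => hd w ?_ ?_)
  · simpa using hw.1
  · simpa using hw.2
  · simpa using (Metric.ball_subset_closedBall hw.1.1)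
  · have := hw.1.2
    simp only [Metric.mem_closedBall, dist_zero_right, not_le] at this
    exact this.le

lemma circleIntegral_besselIntegrand_left (η : ℝ) (m n : ℤ) {w : ℂ} {R R' : ℝ} (hw : w ≠ 0)
    (hR : ‖w‖ < R) (hRR : R ≤ R') :
    (∮ z in C(0, R'), besselIntegrand η m n z w) = ∮ z in C(0, R), besselIntegrand η m n z w := by
  have hR0 : 0 < R := (norm_nonneg w).trans_lt hR
  have hd : ∀ z : ℂ, R ≤ ‖z‖ →
      DifferentiableAt ℂ (fun z => besselIntegrand η m n z w) z := fun z h1 =>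
    differentiableAt_besselIntegrand_left η m n
      (norm_pos_iff.1 (hR0.trans_le h1)) hw (ne_of_norm_lt_norm (hR.trans_le h1))
  refine Complex.circleIntegral_eq_of_differentiable_on_annulus_off_countable hR0 hRR
    Set.countable_empty (fun z hz => (hd z ?_).continuousAt.continuousWithinAt)
    (fun z hz => hd z ?_)
  · simpa using hz.2
  · have := hz.1.2
    simp only [Metric.mem_closedBall, dist_zero_right, not_le] at this
    exact this.le

lemma discreteBesselKernel_eq (R r ξ : ℝ) (m n : ℤ) :
    discreteBesselKernel R r ξ m n = (1 / (2 * (Real.pi : ℂ) * Complex.I) ^ 2) *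
      ∮ z in C(0, R), ∮ w in C(0, r), besselIntegrand (Real.sqrt ξ) m n z w := rfl

lemma discreteBesselKernel_congr_right (ξ : ℝ) (m n : ℤ) {R r r' : ℝ} (hr : 0 < r) (hrr : r ≤ r')
    (hR : r' < R) : discreteBesselKernel R r' ξ m n = discreteBesselKernel R r ξ m n := by
  have hR0 : 0 < R := hr.trans_le (hrr.trans hR.le)
  rw [discreteBesselKernel_eq, discreteBesselKernel_eq]
  congr 1
  refine circleIntegral.integral_congr hR0.le fun z hz => ?_
  refine circleIntegral_besselIntegrand_right _ m n hr hrr ?_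
  rwa [mem_sphere_zero_iff_norm.1 hz]

lemma discreteBesselKernel_congr_left (ξ : ℝ) (m n : ℤ) {R R' r : ℝ} (hr : 0 < r) (hrR : r < R)
    (hRR : R ≤ R') : discreteBesselKernel R' r ξ m n = discreteBesselKernel R r ξ m n := by
  rw [discreteBesselKernel_eq, discreteBesselKernel_eq,
    circleIntegral_circleIntegral_swap
      (continuous_besselIntegrand_circleMap _ m n hr (hrR.trans_le hRR)),
    circleIntegral_circleIntegral_swap (continuous_besselIntegrand_circleMap _ m n hr hrR)]
  congr 1
  refine circleIntegral.integral_congr hr.le fun w hw => ?_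
  have hw' := mem_sphere_zero_iff_norm.1 hw
  exact circleIntegral_besselIntegrand_left _ m n (norm_pos_iff.1 (hw' ▸ hr)) (hw'.symm ▸ hrR) hRR

/-- The discrete Bessel kernel does not depend on the radii of its contours. -/
theorem discreteBesselKernel_radius_indep (ξ : ℝ) (m n : ℤ) {R r R' r' : ℝ} (hr : 0 < r)
    (hrR : r < R) (hr' : 0 < r') (hrR' : r' < R') :
    discreteBesselKernel R r ξ m n = discreteBesselKernel R' r' ξ m n := by
  have h0 : 0 < min r r' := lt_min hr hr'
  rw [discreteBesselKernel_congr_right ξ m n h0 (min_le_left r r') hrR,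
    discreteBesselKernel_congr_right ξ m n h0 (min_le_right r r') hrR',
    ← discreteBesselKernel_congr_left ξ m n h0 ((min_le_left r r').trans_lt hrR)
      (le_max_left R R'),
    ← discreteBesselKernel_congr_left ξ m n h0 ((min_le_right r r').trans_lt hrR')
      (le_max_right R R')]

lemma circleIntegral_eq_integral_neg_pi_pi (f : ℂ → ℂ) (ρ : ℝ) :
    (∮ z in C(0, ρ), f z) =
      ∫ θ in (-Real.pi)..Real.pi, circleMap 0 ρ θ * Complex.I * f (circleMap 0 ρ θ) := by
  have hp : Function.Periodic
      (fun θ : ℝ => circleMap 0 ρ θ * Complex.I * f (circleMap 0 ρ θ)) (2 * Real.pi) := by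
    intro θ
    simp only [periodic_circleMap 0 ρ θ]
  have h := hp.intervalIntegral_add_eq 0 (-Real.pi)
  rw [zero_add, show -Real.pi + 2 * Real.pi = Real.pi by ring] at h
  simpa [circleIntegral, deriv_circleMap] using h

lemma circleIntegral_exp_eq (f : ℂ → ℂ) {h : ℝ} (hh : 0 < h) :
    (∮ z in C(0, Real.exp h), f z) =
      ∫ t in (-(Real.pi / h))..(Real.pi / h), h * Complex.I * Complex.exp (h * airyLine t) *
        f (Complex.exp (h * airyLine t)) := by
  have key : ∀ t : ℝ, circleMap 0 (Real.exp h) (h * t) = Complex.exp (h * airyLine t) := by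
    intro t
    rw [circleMap, zero_add, Complex.ofReal_exp, ← Complex.exp_add, airyLine]
    push_cast
    ring_nf
  rw [circleIntegral_eq_integral_neg_pi_pi]
  set F := fun θ : ℝ => circleMap 0 (Real.exp h) θ * Complex.I * f (circleMap 0 (Real.exp h) θ)
  have hF := intervalIntegral.integral_comp_mul_left (a := -(Real.pi / h)) (b := Real.pi / h) F
    hh.ne'
  rw [mul_neg, mul_div_cancel₀ _ hh.ne'] at hF
  rw [eq_inv_smul_iff₀ hh.ne', Complex.real_smul, ← intervalIntegral.integral_const_mul] at hF
  rw [← hF]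
  refine intervalIntegral.integral_congr fun t _ => ?_
  simp only [F, key]
  ring

lemma circleIntegral_exp_neg_eq (f : ℂ → ℂ) {h : ℝ} (hh : 0 < h) :
    (∮ z in C(0, Real.exp (-h)), f z) =
      ∫ t in (-(Real.pi / h))..(Real.pi / h), h * Complex.I * Complex.exp (-(h * airyLine t)) *
        f (Complex.exp (-(h * airyLine t))) := by
  have key : ∀ t : ℝ, circleMap 0 (Real.exp (-h)) (h * -t) =
      Complex.exp (-(h * airyLine t)) := by
    intro t
    rw [circleMap, zero_add, Complex.ofReal_exp, ← Complex.exp_add, airyLine]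
    push_cast
    ring_nf
  rw [circleIntegral_eq_integral_neg_pi_pi]
  set F := fun θ : ℝ => circleMap 0 (Real.exp (-h)) θ * Complex.I *
    f (circleMap 0 (Real.exp (-h)) θ)
  have hF := intervalIntegral.integral_comp_mul_left (a := -(Real.pi / h)) (b := Real.pi / h) F
    hh.ne'
  rw [mul_neg, mul_div_cancel₀ _ hh.ne'] at hF
  rw [eq_inv_smul_iff₀ hh.ne', Complex.real_smul, ← intervalIntegral.integral_const_mul] at hF
  have hneg := intervalIntegral.integral_comp_neg (a := -(Real.pi / h)) (b := Real.pi / h)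
    (fun t : ℝ => (h : ℂ) * F (h * t))
  rw [neg_neg] at hneg
  rw [← hF, ← hneg]
  refine intervalIntegral.integral_congr fun t _ => ?_
  simp only [F, key]
  ring

/-! ### Edge scaling -/

/-- The rescaled exponential factor of the Bessel kernel at `z = exp (h a)`, `a = 1 + i t`:
`exp (2 h⁻³ (sinh (h a) - h a) - X a)`, which tends to `exp (a³ / 3 - X a)` as `h → 0`. -/
noncomputable def besselEdge (h X t : ℝ) : ℂ :=
  Complex.exp (2 / (h : ℂ) ^ 3 * (Complex.sinh (h * airyLine t) - h * airyLine t) -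
    X * airyLine t)

/-- The rescaled Cauchy factor `h / (2 sinh (h (a + b) / 2))` of the Bessel kernel at
`a = 1 + i t`, `b = 1 + i s`. -/
noncomputable def sinhKernel (h : ℝ) (p : ℝ × ℝ) : ℂ :=
  h / (2 * Complex.sinh (h * (airyLine p.1 + airyLine p.2) / 2))

lemma norm_sinh_sub_le (z : ℂ) :
    ‖Complex.sinh z - z - z ^ 3 / 6‖ ≤ ‖z‖ ^ 4 * Real.exp ‖z‖ := by
  have h1 := Complex.norm_exp_sub_sum_le_norm_mul_exp z 4
  have h2 := Complex.norm_exp_sub_sum_le_norm_mul_exp (-z) 4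
  rw [norm_neg] at h2
  have he : Complex.sinh z - z - z ^ 3 / 6 =
      ((Complex.exp z - ∑ m ∈ Finset.range 4, z ^ m / m.factorial) -
        (Complex.exp (-z) - ∑ m ∈ Finset.range 4, (-z) ^ m / m.factorial)) / 2 := by
    simp only [Finset.sum_range_succ, Finset.sum_range_zero, Complex.sinh, Nat.factorial]
    push_cast
    ring
  rw [he, norm_div, Complex.norm_two, div_le_iff₀ two_pos]
  linarith [norm_sub_le (Complex.exp z - ∑ m ∈ Finset.range 4, z ^ m / m.factorial)
    (Complex.exp (-z) - ∑ m ∈ Finset.range 4, (-z) ^ m / m.factorial)]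

lemma sinh_sub_self_le {h : ℝ} (h0 : 0 < h) (h1 : h ≤ 1) : Real.sinh h - h ≤ 3 * h ^ 3 := by
  have hb := norm_sinh_sub_le h
  have hcast : Complex.sinh h - h - (h : ℂ) ^ 3 / 6 = ((Real.sinh h - h - h ^ 3 / 6 : ℝ) : ℂ) := by
    push_cast; rfl
  rw [hcast, Complex.norm_real, Complex.norm_real, Real.norm_eq_abs, Real.norm_eq_abs,
    abs_of_pos h0] at hb
  have he : Real.exp h ≤ 2.7182818286 := (Real.exp_le_exp.2 h1).trans Real.exp_one_lt_d9.le
  have h3 : 0 < h ^ 3 := by positivity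
  have h4 : h ^ 4 * Real.exp h ≤ h ^ 3 * 2.7182818286 := by
    have : h ^ 4 ≤ h ^ 3 := pow_le_pow_of_le_one h0.le h1 (by norm_num)
    gcongr
  linarith [le_abs_self (Real.sinh h - h - h ^ 3 / 6)]

lemma sinh_mul_airyLine_re (h t : ℝ) :
    (Complex.sinh (h * airyLine t)).re = Real.sinh h * Real.cos (h * t) := by
  have : (h : ℂ) * airyLine t = h + ((h * t : ℝ) : ℂ) * Complex.I := by
    rw [airyLine]; push_cast; ring
  rw [this, Complex.sinh_add, Complex.sinh_mul_I, Complex.cosh_mul_I, ← Complex.ofReal_sinh,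
    ← Complex.ofReal_cosh, ← Complex.ofReal_cos, ← Complex.ofReal_sin]
  simp only [Complex.add_re, Complex.mul_re, Complex.ofReal_re, Complex.ofReal_im, Complex.mul_im,
    Complex.I_re, Complex.I_im]
  ring

/-- The Gaussian domination that makes the scaling limit a consequence of dominated convergence:
`Re (sinh (h a) - h a) = (sinh h - h) - sinh h (1 - cos (h t))` on the line `a = 1 + i t`. -/
lemma norm_besselEdge_le {h X t : ℝ} (h0 : 0 < h) (h1 : h ≤ 1) (ht : |h * t| ≤ Real.pi) :
    ‖besselEdge h X t‖ ≤ Real.exp (6 - X) * Real.exp (-(1 / 4) * t ^ 2) := by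
  rw [besselEdge, Complex.norm_exp, ← Real.exp_add, Real.exp_le_exp]
  have hre : (2 / (h : ℂ) ^ 3 * (Complex.sinh (h * airyLine t) - h * airyLine t) -
      X * airyLine t).re = 2 / h ^ 3 * (Real.sinh h * Real.cos (h * t) - h) - X := by
    have : (2 / (h : ℂ) ^ 3) = ((2 / h ^ 3 : ℝ) : ℂ) := by push_cast; rfl
    rw [this, Complex.sub_re, Complex.re_ofReal_mul, Complex.re_ofReal_mul, Complex.sub_re,
      Complex.re_ofReal_mul, sinh_mul_airyLine_re, airyLine_re, mul_one, mul_one]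
  rw [hre]
  have hcos := Real.cos_le_one_sub_mul_cos_sq ht
  have hs := Real.self_le_sinh_iff.2 h0.le
  have hpi : (1 / 8 : ℝ) ≤ 2 / Real.pi ^ 2 := by
    rw [div_le_div_iff₀ (by norm_num) (by positivity)]
    nlinarith [Real.pi_le_four, Real.pi_pos]
  have hq : (1 / 8 : ℝ) * (h * t) ^ 2 ≤ 1 - Real.cos (h * t) := by
    have : (1 / 8 : ℝ) * (h * t) ^ 2 ≤ 2 / Real.pi ^ 2 * (h * t) ^ 2 := by gcongr
    linarith
  have hm : h * ((1 / 8 : ℝ) * (h * t) ^ 2) ≤ Real.sinh h * (1 - Real.cos (h * t)) := by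
    gcongr
  have hle : Real.sinh h * Real.cos (h * t) - h ≤ h ^ 3 * (3 - 1 / 8 * t ^ 2) := by
    linarith [sinh_sub_self_le h0 h1]
  have : 2 / h ^ 3 * (Real.sinh h * Real.cos (h * t) - h) ≤
      2 / h ^ 3 * (h ^ 3 * (3 - 1 / 8 * t ^ 2)) := by gcongr
  have he : 2 / h ^ 3 * (h ^ 3 * (3 - 1 / 8 * t ^ 2)) = 6 - 1 / 4 * t ^ 2 := by
    field_simp; ring
  linarith

lemma two_mul_re_le_norm_two_sinh {z : ℂ} (hz : 0 ≤ z.re) : 2 * z.re ≤ ‖2 * Complex.sinh z‖ := by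
  have h1 : 2 * Complex.sinh z = Complex.exp z - Complex.exp (-z) := by
    rw [Complex.sinh]; ring
  have h2 := norm_sub_norm_le (Complex.exp z) (Complex.exp (-z))
  rw [Complex.norm_exp, Complex.norm_exp, Complex.neg_re] at h2
  have h3 := Real.self_le_sinh_iff.2 hz
  rw [Real.sinh_eq] at h3
  rw [h1]
  linarith

lemma le_norm_two_sinh {h : ℝ} (h0 : 0 < h) (p : ℝ × ℝ) :
    h ≤ ‖2 * Complex.sinh (h * (airyLine p.1 + airyLine p.2) / 2)‖ := by
  have hre : ((h : ℂ) * (airyLine p.1 + airyLine p.2) / 2).re = h := by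
    rw [mul_div_assoc, Complex.re_ofReal_mul, ← Complex.ofReal_ofNat, Complex.div_ofReal_re]
    simp
  have := two_mul_re_le_norm_two_sinh (hre.symm ▸ h0.le)
  rw [hre] at this
  linarith

lemma two_sinh_ne_zero {h : ℝ} (h0 : 0 < h) (p : ℝ × ℝ) :
    2 * Complex.sinh (h * (airyLine p.1 + airyLine p.2) / 2) ≠ 0 :=
  norm_pos_iff.1 (h0.trans_le (le_norm_two_sinh h0 p))

lemma norm_sinhKernel_le {h : ℝ} (h0 : 0 < h) (p : ℝ × ℝ) : ‖sinhKernel h p‖ ≤ 1 := by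
  have h2 := le_norm_two_sinh h0 p
  rw [sinhKernel, norm_div, Complex.norm_real, Real.norm_eq_abs, abs_of_pos h0]
  exact div_le_one_of_le₀ h2 (norm_nonneg _)

@[fun_prop] lemma continuous_besselEdge (h X : ℝ) : Continuous (besselEdge h X) := by
  unfold besselEdge
  have := Complex.continuous_sinh
  fun_prop

lemma continuous_sinhKernel {h : ℝ} (h0 : 0 < h) : Continuous (sinhKernel h) := by
  unfold sinhKernel
  have := Complex.continuous_sinh
  exact continuous_const.div (by fun_prop) (two_sinh_ne_zero h0)

lemma tendsto_besselEdge {ι : Type*} {l : Filter ι} {h X : ι → ℝ} {x : ℝ}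
    (hpos : ∀ᶠ i in l, 0 < h i) (hh : Tendsto h l (𝓝 0)) (hX : Tendsto X l (𝓝 x)) (t : ℝ) :
    Tendsto (fun i => besselEdge (h i) (X i) t) l (𝓝 (airyExp x t)) := by
  set a := airyLine t with ha
  have hmain : Tendsto (fun i => 2 / (h i : ℂ) ^ 3 * (Complex.sinh (h i * a) - h i * a)) l
      (𝓝 (a ^ 3 / 3)) := by
    rw [tendsto_iff_norm_sub_tendsto_zero]
    have hlim : Tendsto (fun i => 2 * h i * ‖a‖ ^ 4 * Real.exp (h i * ‖a‖)) l (𝓝 0) := by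
      have hc : Continuous fun u : ℝ => 2 * u * ‖a‖ ^ 4 * Real.exp (u * ‖a‖) := by fun_prop
      simpa [Function.comp_def] using (hc.tendsto 0).comp hh
    refine squeeze_zero' (.of_forall fun _ => norm_nonneg _) ?_ hlim
    filter_upwards [hpos] with i hi
    have hi' : (h i : ℂ) ≠ 0 := Complex.ofReal_ne_zero.2 hi.ne'
    have e : 2 / (h i : ℂ) ^ 3 * (Complex.sinh (h i * a) - h i * a) - a ^ 3 / 3 =
        2 / (h i : ℂ) ^ 3 *
          (Complex.sinh (h i * a) - h i * a - (h i * a) ^ 3 / 6) := by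
      field_simp
      ring
    have hb := norm_sinh_sub_le (h i * a)
    rw [norm_mul, Complex.norm_real, Real.norm_eq_abs, abs_of_pos hi] at hb
    rw [e, norm_mul, norm_div, norm_pow, Complex.norm_real, Real.norm_eq_abs, abs_of_pos hi,
      Complex.norm_two]
    calc _ ≤ 2 / h i ^ 3 * ((h i * ‖a‖) ^ 4 * Real.exp (h i * ‖a‖)) := by gcongr
      _ = _ := by field_simp
  have hX' : Tendsto (fun i => (X i : ℂ) * a) l (𝓝 (x * a)) :=
    ((Complex.continuous_ofReal.tendsto x).comp hX).mul_const a
  exact (Complex.continuous_exp.tendsto _).comp (hmain.sub hX')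

lemma tendsto_sinhKernel {ι : Type*} {l : Filter ι} {h : ι → ℝ}
    (hpos : ∀ᶠ i in l, 0 < h i) (hh : Tendsto h l (𝓝 0)) (p : ℝ × ℝ) :
    Tendsto (fun i => sinhKernel (h i) p) l (𝓝 (airyLine p.1 + airyLine p.2)⁻¹) := by
  set c := airyLine p.1 + airyLine p.2 with hc
  have hd : HasDerivAt (fun u : ℝ => 2 * Complex.sinh ((u : ℂ) * c / 2)) c 0 := by
    have h1 : HasDerivAt (fun u : ℂ => 2 * Complex.sinh (u * c / 2)) c ((0 : ℝ) : ℂ) := by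
      refine (((((hasDerivAt_id _).mul_const c).div_const 2).csinh).const_mul 2).congr_deriv ?_
      simp
      ring
    exact h1.comp_ofReal
  have h0 : Tendsto h l (𝓝[≠] 0) :=
    tendsto_nhdsWithin_iff.2 ⟨hh, hpos.mono fun i hi => hi.ne'⟩
  have hs := ((hasDerivAt_iff_tendsto_slope.1 hd).comp h0).inv₀ (airyLine_add_ne_zero p.1 p.2)
  refine hs.congr fun i => ?_
  simp [slope, sinhKernel, div_eq_mul_inv, mul_comm, c]

/-- Scaling limit of the double integral, by dominated convergence. -/
lemma tendsto_integral_besselEdge {h X Y : ℝ → ℝ} {x y : ℝ}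
    (hpos : ∀ᶠ ξ in atTop, 0 < h ξ) (hh : Tendsto h atTop (𝓝 0))
    (hX : Tendsto X atTop (𝓝 x)) (hY : Tendsto Y atTop (𝓝 y)) :
    Tendsto (fun ξ => ∫ p in Set.Ioc (-(Real.pi / h ξ)) (Real.pi / h ξ) ×ˢ
        Set.Ioc (-(Real.pi / h ξ)) (Real.pi / h ξ),
        besselEdge (h ξ) (X ξ) p.1 * besselEdge (h ξ) (Y ξ) p.2 * sinhKernel (h ξ) p)
      atTop (𝓝 (airyDouble x y)) := by
  have hms : ∀ ξ, MeasurableSet (Set.Ioc (-(Real.pi / h ξ)) (Real.pi / h ξ) ×ˢ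
        Set.Ioc (-(Real.pi / h ξ)) (Real.pi / h ξ)) :=
    fun ξ => measurableSet_Ioc.prod measurableSet_Ioc
  simp only [fun ξ => (integral_indicator (μ := volume) (hms ξ) (f := fun p : ℝ × ℝ =>
    besselEdge (h ξ) (X ξ) p.1 * besselEdge (h ξ) (Y ξ) p.2 * sinhKernel (h ξ) p)).symm]
  have hg : Integrable fun t : ℝ => Real.exp (-(1 / 4) * t ^ 2) :=
    integrable_exp_neg_mul_sq (by norm_num)
  refine tendsto_integral_filter_of_dominated_convergence (fun p : ℝ × ℝ =>
    (Real.exp (6 - (x - 1)) * Real.exp (-(1 / 4) * p.1 ^ 2)) *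
      (Real.exp (6 - (y - 1)) * Real.exp (-(1 / 4) * p.2 ^ 2))) ?_ ?_
    ((hg.const_mul _).mul_prod (hg.const_mul _)) ?_
  · filter_upwards [hpos] with ξ hξ
    have := continuous_sinhKernel hξ
    exact AEStronglyMeasurable.indicator (Continuous.aestronglyMeasurable (by fun_prop)) (hms ξ)
  · filter_upwards [hpos, hh.eventually_le_const one_pos,
      hX.eventually_const_le (sub_one_lt x), hY.eventually_const_le (sub_one_lt y)]
      with ξ h0 h1 hx hy
    refine .of_forall fun p => ?_
    by_cases hp : p ∈ Set.Ioc (-(Real.pi / h ξ)) (Real.pi / h ξ) ×ˢ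
        Set.Ioc (-(Real.pi / h ξ)) (Real.pi / h ξ)
    · rw [Set.indicator_of_mem hp]
      have habs : ∀ t ∈ Set.Ioc (-(Real.pi / h ξ)) (Real.pi / h ξ), |h ξ * t| ≤ Real.pi := by
        intro t ht
        have : |t| ≤ Real.pi / h ξ := abs_le.2 ⟨ht.1.le, ht.2⟩
        rw [abs_mul, abs_of_pos h0]
        rwa [le_div_iff₀' h0] at this
      rw [norm_mul, norm_mul]
      refine (mul_le_of_le_one_right (by positivity) (norm_sinhKernel_le h0 p)).trans ?_
      gcongr
      · refine (norm_besselEdge_le h0 h1 (habs _ hp.1)).trans ?_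
        gcongr
      · refine (norm_besselEdge_le h0 h1 (habs _ hp.2)).trans ?_
        gcongr
    · rw [Set.indicator_of_notMem hp, norm_zero]
      positivity
  · refine .of_forall fun p => ?_
    have hlim := ((tendsto_besselEdge hpos hh hX p.1).mul
      (tendsto_besselEdge hpos hh hY p.2)).mul (tendsto_sinhKernel hpos hh p)
    refine hlim.congr' ?_
    -- every point eventually lies in the growing square of integration
    have hinv : Tendsto (fun ξ => Real.pi / h ξ) atTop atTop :=
      Tendsto.const_mul_atTop Real.pi_pos
        (tendsto_inv_nhdsGT_zero.comp (tendsto_nhdsWithin_iff.2 ⟨hh, hpos⟩))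
    filter_upwards [hinv.eventually_gt_atTop |p.1|, hinv.eventually_gt_atTop |p.2|]
      with ξ hp1 hp2
    rw [Set.indicator_of_mem]
    exact ⟨⟨(abs_lt.1 hp1).1, (abs_lt.1 hp1).2.le⟩, ⟨(abs_lt.1 hp2).1, (abs_lt.1 hp2).2.le⟩⟩

/-- The integrand of the Bessel kernel at `z = exp (h a)`, `w = exp (-h b)`. It factors
symmetrically because `z - w = exp (h (a - b) / 2) * 2 sinh (h (a + b) / 2)`; the prefactor is what
turns the exponents `m + 1` and `n` into the half-integers `m + 1 / 2` and `n + 1 / 2`. -/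
lemma besselIntegrand_exp {h : ℝ} (h0 : 0 < h) (m n : ℤ) (p : ℝ × ℝ) :
    h * Complex.exp (h * airyLine p.1) * Complex.exp (-(h * airyLine p.2)) *
      besselIntegrand (h ^ 3)⁻¹ m n (Complex.exp (h * airyLine p.1))
        (Complex.exp (-(h * airyLine p.2))) =
      besselEdge h ((m + 1 / 2 - 2 * (h ^ 3)⁻¹) * h) p.1 *
        besselEdge h ((n + 1 / 2 - 2 * (h ^ 3)⁻¹) * h) p.2 * sinhKernel h p := by
  have hh : (h : ℂ) ≠ 0 := Complex.ofReal_ne_zero.2 h0.ne'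
  set a := airyLine p.1 with ha
  set b := airyLine p.2 with hb
  have hS := two_sinh_ne_zero h0 p
  rw [← ha, ← hb] at hS
  have hden : Complex.exp (h * a) - Complex.exp (-(h * b)) =
      Complex.exp ((h * a - h * b) / 2) * (2 * Complex.sinh (h * (a + b) / 2)) := by
    rw [Complex.sinh, mul_div_cancel₀ _ (two_ne_zero), mul_sub, ← Complex.exp_add,
      ← Complex.exp_add]
    congr 2 <;> ring
  have hsinh : ∀ u : ℂ, Complex.exp u - Complex.exp (-u) = 2 * Complex.sinh u := by
    intro u; rw [Complex.sinh]; ring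
  rw [besselIntegrand, sinhKernel, ← ha, ← hb, hden, ← Complex.exp_int_mul,
    ← Complex.exp_int_mul, ← Complex.exp_neg, ← Complex.exp_neg, neg_neg, ← Complex.exp_add,
    one_div, ← Complex.exp_neg]
  have e1 : Complex.exp (h * a) - Complex.exp (-(h * a)) - Complex.exp (-(h * b)) +
      Complex.exp (h * b) = 2 * Complex.sinh (h * a) + 2 * Complex.sinh (h * b) := by
    rw [← hsinh, ← hsinh]; ring
  rw [e1, div_mul_eq_div_div, div_eq_mul_inv (Complex.exp _) (Complex.exp _), ← Complex.exp_neg,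
    besselEdge, besselEdge, ← ha, ← hb]
  have hcomb : ∀ u1 u2 u3 u4 u5 v1 v2 S : ℂ, u1 + u2 + u3 + u4 + u5 = v1 + v2 →
      h * Complex.exp u1 * Complex.exp u2 * (Complex.exp u3 * Complex.exp u4 / S *
        Complex.exp u5) = Complex.exp v1 * Complex.exp v2 * (h / S) := by
    intro u1 u2 u3 u4 u5 v1 v2 S hu
    rw [← Complex.exp_add v1, ← hu]
    simp only [Complex.exp_add]
    ring
  apply hcomb
  push_cast
  field_simp
  ring

/-- The rescaled Bessel kernel as an integral over a square, from the contours `|z| = exp h` and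
`|w| = exp (-h)`. -/
lemma discreteBesselKernel_eq_setIntegral {R r ξ h : ℝ} (hr : 0 < r) (hrR : r < R) (h0 : 0 < h)
    (hξ : Real.sqrt ξ = (h ^ 3)⁻¹) (m n : ℤ) :
    (h⁻¹ : ℂ) * discreteBesselKernel R r ξ m n = (4 * (Real.pi : ℂ) ^ 2)⁻¹ *
      ∫ p in Set.Ioc (-(Real.pi / h)) (Real.pi / h) ×ˢ Set.Ioc (-(Real.pi / h)) (Real.pi / h),
        besselEdge h ((m + 1 / 2 - 2 * (h ^ 3)⁻¹) * h) p.1 *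
          besselEdge h ((n + 1 / 2 - 2 * (h ^ 3)⁻¹) * h) p.2 * sinhKernel h p := by
  have hh : (h : ℂ) ≠ 0 := Complex.ofReal_ne_zero.2 h0.ne'
  have hle : -(Real.pi / h) ≤ Real.pi / h := by
    have := div_pos Real.pi_pos h0
    linarith
  rw [discreteBesselKernel_radius_indep ξ m n hr hrR (Real.exp_pos (-h))
    (Real.exp_lt_exp.2 (show -h < h by linarith)), discreteBesselKernel_eq, hξ,
    circleIntegral_exp_eq _ h0]
  simp only [circleIntegral_exp_neg_eq _ h0]
  have hc : Continuous fun p : ℝ × ℝ => besselEdge h ((m + 1 / 2 - 2 * (h ^ 3)⁻¹) * h) p.1 *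
          besselEdge h ((n + 1 / 2 - 2 * (h ^ 3)⁻¹) * h) p.2 * sinhKernel h p := by
    have := continuous_sinhKernel h0
    fun_prop
  rw [Measure.volume_eq_prod, setIntegral_prod _ (IntegrableOn.mono_set
    (hc.continuousOn.integrableOn_compact (isCompact_Icc.prod isCompact_Icc))
    (Set.prod_mono Set.Ioc_subset_Icc_self Set.Ioc_subset_Icc_self)),
    ← intervalIntegral.integral_of_le hle]
  simp only [← intervalIntegral.integral_of_le hle]
  simp only [← intervalIntegral.integral_const_mul]
  refine intervalIntegral.integral_congr fun t _ => ?_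
  refine intervalIntegral.integral_congr fun s _ => ?_
  have hpi : (Real.pi : ℂ) ≠ 0 := Complex.ofReal_ne_zero.2 Real.pi_ne_zero
  rw [← besselIntegrand_exp h0 m n (t, s)]
  set B := besselIntegrand (h ^ 3)⁻¹ m n (Complex.exp (h * airyLine t))
    (Complex.exp (-(h * airyLine s)))
  simp only [mul_pow, Complex.I_sq]
  field_simp
  rw [Complex.I_sq]
  ring

theorem mainTheorem3 :
    -- the improper integral defining `Ai` converges, and `Ai` is differentiable
    (∀ x : ℝ, Filter.Tendsto
      (fun T : ℝ => (1 / Real.pi) * ∫ s in (0 : ℝ)..T, Real.cos (s ^ 3 / 3 + s * x))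
      Filter.atTop (nhds (airyAi x))) ∧
    Differentiable ℝ airyAi ∧
    -- edge limit, along half-integers `m ξ + 1/2`, `n ξ + 1/2` with rescaled limits `x`, `y`
    ∀ (R r : ℝ), 0 < r → r < R → ∀ (x y : ℝ) (m n : ℝ → ℤ),
      Filter.Tendsto
        (fun ξ : ℝ => ((m ξ : ℝ) + 1 / 2 - 2 * Real.sqrt ξ) / ξ ^ (1 / 6 : ℝ))
        Filter.atTop (nhds x) →
      Filter.Tendsto
        (fun ξ : ℝ => ((n ξ : ℝ) + 1 / 2 - 2 * Real.sqrt ξ) / ξ ^ (1 / 6 : ℝ))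
        Filter.atTop (nhds y) →
      Filter.Tendsto
        (fun ξ : ℝ => ((ξ ^ (1 / 6 : ℝ) : ℝ) : ℂ) * discreteBesselKernel R r ξ (m ξ) (n ξ))
        Filter.atTop (nhds ((airyKernel x y : ℝ) : ℂ)) := by
  refine ⟨tendsto_airyAi, differentiable_airyAi, fun R r hr hrR x y m n hx hy => ?_⟩
  -- the scale of the saddle point at `z = 1` is `h = ξ ^ (-1 / 6)`, for which `√ξ = h⁻³`
  have hpos : ∀ᶠ ξ : ℝ in atTop, 0 < (ξ ^ (1 / 6 : ℝ))⁻¹ := by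
    filter_upwards [eventually_gt_atTop 0] with ξ hξ
    positivity
  have hh : Tendsto (fun ξ : ℝ => (ξ ^ (1 / 6 : ℝ))⁻¹) atTop (𝓝 0) :=
    (tendsto_rpow_atTop (by norm_num)).inv_tendsto_atTop
  have hpi : (4 * (Real.pi : ℂ) ^ 2) ≠ 0 := by simp [Real.pi_ne_zero]
  have hlim := (tendsto_integral_besselEdge hpos hh hx hy).const_mul (4 * (Real.pi : ℂ) ^ 2)⁻¹
  rw [airyDouble_eq_airyKernel, inv_mul_cancel_left₀ hpi] at hlim
  refine hlim.congr' ?_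
  filter_upwards [hpos, eventually_gt_atTop 0] with ξ h0 hξ
  have hsqrt : Real.sqrt ξ = (((ξ ^ (1 / 6 : ℝ))⁻¹) ^ 3)⁻¹ := by
    rw [inv_pow, inv_inv, ← Real.rpow_natCast, ← Real.rpow_mul hξ.le, Real.sqrt_eq_rpow]
    norm_num
  have h := discreteBesselKernel_eq_setIntegral hr hrR h0 hsqrt (m ξ) (n ξ)
  rw [← hsqrt, Complex.ofReal_inv, inv_inv] at h
  rw [h]
  simp only [div_eq_mul_inv]
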